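/- An augmented simplicial set is a simplicial set $X$ together with a set $X_{-1}$ and a map $q_X : X_0 \to X_{-1}$ with $q_X d_0 = q_X d_1$. The join $X \odot Y$ of two augmented simplicial sets has $$(X \odot Y)_n = \bigsqcup_{i=-1}^{n} X_{n-1-i} \times Y_i \qquad (n \ge -1),$$ where, for $(x,y) \in X_p \times Y_q$ with $p + q + 1 = n$, one has $d_i(x,y) = (d_i x, y)$ and $s_i(x,y) = (s_i x, y)$ for $0 \le i \le p$, and $d_i(x,y) = (x, d_{i-p-1} y)$ and $s_i(x,y) = (x, s_{i-p-1} y)$ for $p < i \le n$; here $d_0$ on $0$-simplices denotes the augmentation. The geometric realisation $|X|$ of an augmented simplicial set is the usual geometric realisation of its underlying simplicial set. Let $S^0$ be the disjoint union $\triangle[0] \sqcup \triangle[0]$ of two points with the trivial augmentation ($S^0_{-1}$ is a one-point set), and for $n \ge 0$ let $$S^n = \underbrace{S^0 \odot \cdots \odot S^0}_{n+1},$$ bracketed to the left, that is, $S^{n+1} = S^n \odot S^0$. Then: 1. for all $p, q \ge 0$ there is an isomorphism of augmented simplicial sets $S^p \odot S^q \cong S^{p+q+1}$; 2. for all $n \ge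 0$ the realisation $|S^n|$ is homeomorphic to the topological $n$-sphere, the unit sphere of $\mathbb{R}^{n+1}$. -/

import Mathlib

open CategoryTheory Opposite

universe u

namespace AugJoin

/-- An augmented simplicial set: a simplicial set `X` (`X.left`), a set `X₋₁` (`X.right`) and an
augmentation, given as a morphism from `X` to the constant simplicial set `X₋₁`; this is the same
thing as a map `q : X₀ → X₋₁` with `q d₀ = q d₁`. -/
abbrev ASS := SimplicialObject.Augmented (Type u)

/-- The trivial augmentation of a simplicial set: `X₋₁` is the one-point set. -/
def trivialAugmentation (X : SSet.{u}) : ASS.{u} where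
  left := X
  right := PUnit
  hom := { app := fun _ => TypeCat.ofHom fun _ => PUnit.unit }

/-- The geometric realisation of an augmented simplicial set: forget the augmentation and take
the usual geometric realisation. -/
noncomputable def realisation (X : ASS.{u}) : TopCat.{u} :=
  SSet.toTop.obj (SimplicialObject.Augmented.drop.obj X)

/-! ### Augmented simplicial sets as presheaves on finite ordinals, the empty one included -/

/-- The simplices of `X` with `n` vertices, that is, the set `X_{n-1}`. -/
def simplices (X : ASS.{u}) : ℕ → Type u
  | 0 => X.right
  | n + 1 => X.left.obj (op (.mk n))

/-- The operator `X_{n-1} → X_{m-1}` induced by a monotone map from the ordinal with `m` elements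
to the ordinal with `n` elements (which is the augmentation map when `m = 0 < n`). -/
def pull (X : ASS.{u}) : {m n : ℕ} → (Fin m →o Fin n) → simplices X n → simplices X m
  | 0, 0, _ => id
  | 0, n + 1, _ => fun x => X.hom.app (op (.mk n)) x
  | _ + 1, 0, f => (f 0).elim0
  | _ + 1, _ + 1, f => fun x => X.left.map (SimplexCategory.mkHom f).op x

theorem pull_id (X : ASS.{u}) : ∀ {n : ℕ} (x : simplices X n), pull X OrderHom.id x = x
  | 0, _ => rfl
  | n + 1, x => by
    have h := X.left.map_id (op (.mk n))
    exact congrArg (fun φ : X.left.obj (op (.mk n)) ⟶ X.left.obj (op (SimplexCategory.mk n)) => φ x) h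

theorem pull_comp (X : ASS.{u}) : ∀ {k m n : ℕ} (g : Fin k →o Fin m) (f : Fin m →o Fin n)
    (x : simplices X n), pull X (f.comp g) x = pull X g (pull X f x)
  | 0, 0, 0, _, _, _ => rfl
  | 0, 0, _ + 1, _, _, _ => rfl
  | _, _ + 1, 0, _, f, _ => (f 0).elim0
  | _ + 1, 0, _, g, _, _ => (g 0).elim0
  | 0, m + 1, n + 1, _, f, x => by
    have h := X.hom.naturality (SimplexCategory.mkHom f).op
    exact (congrArg (fun φ : X.left.obj (op (.mk n)) ⟶ X.right => φ x) h).symm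
  | k + 1, m + 1, n + 1, g, f, x => by
    have h := X.left.map_comp (SimplexCategory.mkHom f).op
      (SimplexCategory.mkHom g).op
    exact congrArg (fun φ : X.left.obj (op (.mk n)) ⟶ X.left.obj (op (SimplexCategory.mk k)) => φ x) h

/-! ### The ordinal sum, and the decomposition of a monotone map along it -/

/-- The ordinal sum of two monotone maps: `f₀` on the first block and `f₁` on the second one. -/
def ordSum {m₀ m₁ n₀ n₁ : ℕ} (f₀ : Fin m₀ →o Fin n₀) (f₁ : Fin m₁ →o Fin n₁) :
    Fin (m₀ + m₁) →o Fin (n₀ + n₁) where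
  toFun := Fin.addCases (fun i => Fin.castAdd n₁ (f₀ i)) (fun j => Fin.natAdd n₀ (f₁ j))
  monotone' := by
    intro i j
    refine Fin.addCases (fun i => ?_) (fun i => ?_) i <;>
      refine Fin.addCases (fun j => ?_) (fun j => ?_) j <;> intro h
    · have := f₀.monotone (show i ≤ j from h)
      simp only [Fin.addCases_left, Fin.le_def, Fin.val_castAdd] at this ⊢
      exact this
    · simp only [Fin.addCases_left, Fin.addCases_right, Fin.le_def, Fin.val_castAdd,
        Fin.val_natAdd]
      omega
    · simp only [Fin.le_def, Fin.val_castAdd, Fin.val_natAdd] at h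
      omega
    · simpa using f₁.monotone (by simpa using h)

/-- The number of elements that `f` sends into the first `a` elements of its target. -/
def cut {m n : ℕ} (f : Fin m →o Fin n) (a : ℕ) : ℕ :=
  (Finset.univ.filter fun i => (f i : ℕ) < a).card

theorem cut_le {m n : ℕ} (f : Fin m →o Fin n) (a : ℕ) : cut f a ≤ m :=
  (Finset.card_le_univ _).trans (by simp)

theorem lt_cut_iff {m n : ℕ} (f : Fin m →o Fin n) (a : ℕ) (i : Fin m) :
    (i : ℕ) < cut f a ↔ (f i : ℕ) < a := by
  constructor
  · intro h
    by_contra hi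
    have hsub : (Finset.univ.filter fun j => (f j : ℕ) < a) ⊆ Finset.Iio i := by
      intro j hj
      simp only [Finset.mem_filter, Finset.mem_univ, true_and] at hj
      simp only [Finset.mem_Iio]
      by_contra hij
      have := f.monotone (not_lt.mp hij)
      rw [Fin.le_def] at this
      omega
    have := Finset.card_le_card hsub
    rw [Fin.card_Iio] at this
    unfold cut at h
    omega
  · intro h
    have hsub : Finset.Iic i ⊆ (Finset.univ.filter fun j => (f j : ℕ) < a) := by
      intro j hj
      simp only [Finset.mem_Iic] at hj
      have := f.monotone hj
      rw [Fin.le_def] at this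
      simp only [Finset.mem_filter, Finset.mem_univ, true_and]
      omega
    have := Finset.card_le_card hsub
    rw [Fin.card_Iic] at this
    unfold cut
    omega

/-- The part of `f` that lies over the first `a` elements of the target. -/
def fstPart {m n a b : ℕ} (f : Fin m →o Fin n) (_h : a + b = n) : Fin (cut f a) →o Fin a where
  toFun i := ⟨f (Fin.castLE (cut_le f a) i), (lt_cut_iff f a _).mp i.isLt⟩
  monotone' := fun i j hij => f.monotone (a := Fin.castLE (cut_le f a) i)
    (b := Fin.castLE (cut_le f a) j) hij

/-- The part of `f` that lies over the last `b` elements of the target. -/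
def sndPart {m n a b : ℕ} (f : Fin m →o Fin n) (h : a + b = n) :
    Fin (m - cut f a) →o Fin b where
  toFun j := ⟨(f ⟨cut f a + j, by omega⟩ : ℕ) - a, by
    have h1 := (f ⟨cut f a + j, by omega⟩).isLt
    have h2 := (lt_cut_iff f a ⟨cut f a + j, by omega⟩).not.mp (by simp)
    omega⟩
  monotone' := by
    intro i j hij
    have := f.monotone (a := ⟨cut f a + i, by omega⟩) (b := ⟨cut f a + j, by omega⟩)
      (by simpa using hij)
    rw [Fin.le_def] at this ⊢
    exact Nat.sub_le_sub_right this a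

/-! ### The combinatorial join -/

/-- The simplices of the join of `X` and `Y` with `n` vertices: the disjoint union, over all
`a + b = n` with `a, b ≥ 0`, of `X_{a-1} × Y_{b-1}`. -/
structure JoinSimplex (X Y : ASS.{u}) (n : ℕ) : Type u where
  a : ℕ
  b : ℕ
  add_eq : a + b = n
  x : simplices X a
  y : simplices Y b

/-- The operator on the join induced by a monotone map `f`: decompose `f` as an ordinal sum
`f₀ or f₁` and send `(x, y)` to `(f₀* x, f₁* y)`. -/
def joinPull (X Y : ASS.{u}) {m n : ℕ} (f : Fin m →o Fin n) (z : JoinSimplex X Y n) :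
    JoinSimplex X Y m where
  a := cut f z.a
  b := m - cut f z.a
  add_eq := Nat.add_sub_of_le (cut_le f z.a)
  x := pull X (fstPart f z.add_eq) z.x
  y := pull Y (sndPart f z.add_eq) z.y

/-- The characterisation of the structure maps of the join: if `f` restricts to `f₀` on
the first block and to `f₁` on the second block, then `f* (x, y) = (f₀* x, f₁* y)`. -/
theorem joinPull_eq (X Y : ASS.{u}) {m n a b a' b' : ℕ} (f : Fin m →o Fin n)
    (h : a + b = n) (h' : a' + b' = m) (f₀ : Fin a' →o Fin a) (f₁ : Fin b' →o Fin b)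
    (e₀ : ∀ i : Fin a', (f ⟨i, by omega⟩ : ℕ) = f₀ i)
    (e₁ : ∀ j : Fin b', (f ⟨a' + j, by omega⟩ : ℕ) = a + f₁ j)
    (x : simplices X a) (y : simplices Y b) :
    joinPull X Y f ⟨a, b, h, x, y⟩ = ⟨a', b', h', pull X f₀ x, pull Y f₁ y⟩ := by
  have hc : cut f a = a' := by
    apply le_antisymm
    · by_contra hlt
      have hm := cut_le f a
      have h1 := (lt_cut_iff f a ⟨a' + (⟨0, by omega⟩ : Fin b'), by simp; omega⟩).mp
        (by simp; omega)
      rw [e₁] at h1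
      omega
    · by_contra hlt
      have h1 := (lt_cut_iff f a ⟨cut f a, by omega⟩).mpr
        (by rw [e₀ ⟨cut f a, by omega⟩]; exact Fin.isLt _)
      exact lt_irrefl _ h1
  have hb : m - cut f a = b' := by omega
  subst hc
  subst hb
  have g₀ : fstPart f h = f₀ := by
    ext i
    exact e₀ i
  have g₁ : sndPart f h = f₁ := by
    ext j
    have := e₁ j
    change (f ⟨cut f a + j, _⟩ : ℕ) - a = f₁ j
    omega
  simp only [joinPull, g₀, g₁]

theorem joinPull_ordSum (X Y : ASS.{u}) {a b a' b' : ℕ} (f₀ : Fin a' →o Fin a)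
    (f₁ : Fin b' →o Fin b) (x : simplices X a) (y : simplices Y b) :
    joinPull X Y (ordSum f₀ f₁) ⟨a, b, rfl, x, y⟩ = ⟨a', b', rfl, pull X f₀ x, pull Y f₁ y⟩ := by
  refine joinPull_eq X Y (ordSum f₀ f₁) rfl rfl f₀ f₁ (fun i => ?_) (fun j => ?_) x y
  · exact congrArg Fin.val (Fin.addCases_left (motive := fun _ => Fin (a + b))
      (left := fun i => Fin.castAdd b (f₀ i)) (right := fun j => Fin.natAdd a (f₁ j)) i)
  · exact congrArg Fin.val (Fin.addCases_right (motive := fun _ => Fin (a + b))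
      (left := fun i => Fin.castAdd b (f₀ i)) (right := fun j => Fin.natAdd a (f₁ j)) j)

theorem joinPull_id (X Y : ASS.{u}) {n : ℕ} (z : JoinSimplex X Y n) :
    joinPull X Y OrderHom.id z = z := by
  obtain ⟨a, b, h, x, y⟩ := z
  rw [joinPull_eq X Y OrderHom.id h h OrderHom.id OrderHom.id (fun _ => rfl) (fun _ => rfl),
    pull_id, pull_id]

theorem joinPull_comp (X Y : ASS.{u}) {k m n : ℕ} (g : Fin k →o Fin m) (f : Fin m →o Fin n)
    (z : JoinSimplex X Y n) :
    joinPull X Y (f.comp g) z = joinPull X Y g (joinPull X Y f z) := by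
  obtain ⟨a, b, h, x, y⟩ := z
  have hf := cut_le f a
  have hg := cut_le g (cut f a)
  have hfm : cut f a + (m - cut f a) = m := by omega
  rw [joinPull_eq X Y (f.comp g) h (Nat.add_sub_of_le hg)
    ((fstPart f h).comp (fstPart g hfm)) ((sndPart f h).comp (sndPart g hfm))
    (fun i => rfl) (fun j => ?_)]
  · simp only [joinPull, pull_comp]
  · have h1 := (lt_cut_iff g (cut f a) ⟨cut g (cut f a) + j, by omega⟩).not.mp (by simp)
    have h2 := (lt_cut_iff f a (g ⟨cut g (cut f a) + j, by omega⟩)).not.mp h1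
    have h3 : (⟨cut f a + ((g ⟨cut g (cut f a) + j, by omega⟩ : ℕ) - cut f a), by omega⟩ : Fin m)
        = g ⟨cut g (cut f a) + j, by omega⟩ := by
      ext
      simp only
      omega
    change (f (g ⟨cut g (cut f a) + j, _⟩) : ℕ) =
      a + ((f ⟨cut f a + ((g ⟨cut g (cut f a) + j, _⟩ : ℕ) - cut f a), _⟩ : ℕ) - a)
    rw [h3]
    omega

/-- The join of two augmented simplicial sets: its set of `n`-simplices is the disjoint union of
the `X_p × Y_q` with `p + q + 1 = n` and `p, q ≥ -1`, and its augmentation is the operator of the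
inclusion of the empty ordinal. -/
def join (X Y : ASS.{u}) : ASS.{u} where
  left :=
    { obj := fun Δ => JoinSimplex X Y (Δ.unop.len + 1)
      map := fun f => TypeCat.ofHom (joinPull X Y f.unop.toOrderHom)
      map_id := fun Δ => by
        ext z
        exact joinPull_id X Y z
      map_comp := fun f g => by
        ext z
        exact joinPull_comp X Y g.unop.toOrderHom f.unop.toOrderHom z }
  right := JoinSimplex X Y 0
  hom :=
    { app := fun Δ => TypeCat.ofHom
        (joinPull X Y (⟨Fin.elim0, fun i => i.elim0⟩ : Fin 0 →o Fin (Δ.unop.len + 1)))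
      naturality := fun Δ Δ' f => by
        ext z
        refine (joinPull_comp X Y _ f.unop.toOrderHom z).symm.trans ?_
        exact congrArg (fun φ => joinPull X Y φ z) (OrderHom.ext _ _ (funext fun i => i.elim0)) }


/-- The simplicial `0`-sphere: the disjoint union of two copies of `Δ[0]`, trivially augmented. -/
def sphereZero : ASS.{u} :=
  trivialAugmentation (FunctorToTypes.coprod (SSet.stdSimplex.obj (SimplexCategory.mk 0))
    (SSet.stdSimplex.obj (SimplexCategory.mk 0)))

/-- The simplicial `n`-sphere: the join of `n + 1` copies of the simplicial `0`-sphere (bracketed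
to the left). -/
def simplicialSphere : ℕ → ASS.{u}
  | 0 => sphereZero
  | n + 1 => join (simplicialSphere n) sphereZero

end AugJoin

/-! A join of nerves is a nerve. Say that `X` is the augmented nerve of a poset `P` if its simplices
with `n` vertices are, naturally, the monotone maps from the `n`-element ordinal to `P`. A monotone
map into a lexicographic sum splits uniquely into an initial block landing in `P` and a final block
landing in `Q`, so the join of the nerves of `P` and `Q` is the nerve of `P ⊕ₗ Q`
(`NerveModel.join`). Since S⁰ is the nerve of the two-point antichain, Sⁿ is the nerve of an
(n+1)-fold lexicographic sum of antichains, namely `SignedIndex (n + 1)`. Such sums add up the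
numbers of indices (`SignedIndex.sumEquiv`), so both sides of the first claim are nerves of the same
poset, and `NerveModel.iso` applies.

For the realisation, read `SignedIndex N` as the vertices ± eᵢ of the cross-polytope in ℝᴺ, whose
proper faces are spanned by the strict chains. Radial projection of convex combinations is
compatible with the simplicial operators, so it glues to a continuous map to the sphere
(`exists_toSphere`). Every chain lies in a facet, one for each sign pattern
(`exists_eq_facet_comp`), so bijectivity is checked on facets, where absolute values of coordinates
recover the barycentric ones (`eq_of_radial_facet_eq`, `exists_radial_facet_eq`). Finitely many
facets cover the realisation, which is therefore compact, and a continuous bijection from a compact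
space to a Hausdorff space is a homeomorphism. -/

namespace AugJoin

/-! ### Augmented nerves of posets and their uniqueness. -/

/-- A natural identification of the simplices of `X` with `n` vertices with the monotone maps from
the ordinal with `n` elements to `P`: that is, `X` is the augmented nerve of `P`. -/
structure NerveModel (X : ASS.{u}) (P : Type*) [PartialOrder P] where
  equiv : ∀ n, simplices X n ≃ (Fin n →o P)
  equiv_pull : ∀ {m n : ℕ} (f : Fin m →o Fin n) (x : simplices X n),
    equiv m (pull X f x) = (equiv n x).comp f

namespace NerveModel

variable {X Y : ASS.{u}} {P Q : Type*} [PartialOrder P] [PartialOrder Q]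

theorem equiv_symm_comp (M : NerveModel X P) {m n : ℕ} (f : Fin m →o Fin n) (g : Fin n →o P) :
    (M.equiv m).symm (g.comp f) = pull X f ((M.equiv n).symm g) := by
  rw [Equiv.symm_apply_eq, M.equiv_pull, Equiv.apply_symm_apply]

/-- Transport of a nerve model along an order isomorphism. -/
def congr (M : NerveModel X P) (e : P ≃o Q) : NerveModel X Q where
  equiv n := (M.equiv n).trans
    { toFun := fun g => (e : P →o Q).comp g
      invFun := fun g => (e.symm : Q →o P).comp g
      left_inv := fun g => by ext; simp
      right_inv := fun g => by ext; simp }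
  equiv_pull f x := by
    simp only [Equiv.trans_apply, M.equiv_pull]
    rfl

/-- Compatible bijections between the simplices of two nerves of the same poset. -/
def comparison (M : NerveModel X P) (N : NerveModel Y P) (n : ℕ) :
    simplices X n ≃ simplices Y n :=
  (M.equiv n).trans (N.equiv n).symm

theorem comparison_pull (M : NerveModel X P) (N : NerveModel Y P) {m n : ℕ}
    (f : Fin m →o Fin n) (x : simplices X n) :
    M.comparison N m (pull X f x) = pull Y f (M.comparison N n x) := by
  simp only [comparison, Equiv.trans_apply, M.equiv_pull, N.equiv_symm_comp]

/-- Two augmented simplicial sets which are nerves of the same poset are isomorphic. -/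
def iso (M : NerveModel X P) (N : NerveModel Y P) : X ≅ Y :=
  Comma.isoMk
    (NatIso.ofComponents (fun Δ => (M.comparison N (Δ.unop.len + 1)).toIso) (by
      intro Δ Δ' f
      ext x
      exact M.comparison_pull N f.unop.toOrderHom x))
    (M.comparison N 0).toIso
    (by
      ext Δ x
      exact (M.comparison_pull N (⟨Fin.elim0, fun i => i.elim0⟩ : Fin 0 →o Fin (Δ.unop.len + 1))
        x).symm)

end NerveModel

/-! ### The join of two nerves -/

section

variable {P Q : Type*} [PartialOrder P] [PartialOrder Q]

/-- The monotone map to a lexicographic sum given by a monotone map to each summand. -/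
def joinMap {a b n : ℕ} (h : a + b = n) (f : Fin a →o P) (g : Fin b →o Q) :
    Fin n →o P ⊕ₗ Q where
  toFun i := if hi : (i : ℕ) < a then Sum.inlₗ (f ⟨i, hi⟩) else Sum.inrₗ (g ⟨i - a, by omega⟩)
  monotone' i j hij := by
    have hij' : (i : ℕ) ≤ j := hij
    dsimp only
    split_ifs with hi hj hj
    · exact Sum.Lex.inl_le_inl_iff.2 (f.monotone hij')
    · exact Sum.Lex.inl_le_inr _ _
    · omega
    · exact Sum.Lex.inr_le_inr_iff.2 (g.monotone (Nat.sub_le_sub_right hij' a))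

theorem joinMap_of_lt {a b n : ℕ} (h : a + b = n) (f : Fin a →o P) (g : Fin b →o Q) (i : Fin n)
    (hi : (i : ℕ) < a) : joinMap h f g i = Sum.inlₗ (f ⟨i, hi⟩) :=
  dif_pos hi

theorem joinMap_of_not_lt {a b n : ℕ} (h : a + b = n) (f : Fin a →o P) (g : Fin b →o Q)
    (i : Fin n) (hi : ¬(i : ℕ) < a) : joinMap h f g i = Sum.inrₗ (g ⟨i - a, by omega⟩) :=
  dif_neg hi

/-- The index of the summand of a lexicographic sum. -/
def summand : P ⊕ₗ Q →o Fin 2 where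
  toFun z := Sum.elim (fun _ => 0) (fun _ => 1) (ofLex z)
  monotone' x y hxy := by
    cases hxy with
    | inl _ => exact le_rfl
    | inr _ => exact le_rfl
    | sep _ _ => exact Fin.zero_le _

/-- Composing with the monotone map `summand` to a two-element ordinal shows that the indices
landing in `P` form an initial segment; its length is the cut at 1. -/
theorem exists_eq_joinMap {n : ℕ} (g : Fin n →o P ⊕ₗ Q) :
    ∃ (a b : ℕ) (h : a + b = n) (f₀ : Fin a →o P) (f₁ : Fin b →o Q), g = joinMap h f₀ f₁ := by
  set a := cut (summand.comp g) 1 with ha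
  have hle : a ≤ n := cut_le _ _
  have hl : ∀ i : Fin n, (i : ℕ) < a → ∃ p : P, g i = Sum.inlₗ p := by
    intro i hi
    have : (summand (g i) : ℕ) < 1 := (lt_cut_iff (summand.comp g) 1 i).1 hi
    rcases hg : ofLex (g i) with p | q
    · exact ⟨p, hg⟩
    · rw [show g i = Sum.inrₗ q from hg] at this
      exact absurd this (lt_irrefl 1)
  have hr : ∀ i : Fin n, ¬(i : ℕ) < a → ∃ q : Q, g i = Sum.inrₗ q := by
    intro i hi
    have : ¬(summand (g i) : ℕ) < 1 := (lt_cut_iff (summand.comp g) 1 i).not.1 hi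
    rcases hg : ofLex (g i) with p | q
    · rw [show g i = Sum.inlₗ p from hg] at this
      exact absurd Nat.zero_lt_one this
    · exact ⟨q, hg⟩
  choose p hp using fun i : Fin a => hl ⟨i, by omega⟩ i.isLt
  choose q hq using fun j : Fin (n - a) => hr ⟨a + j, by omega⟩ (by simp)
  refine ⟨a, n - a, by omega, ⟨p, fun i j hij => ?_⟩, ⟨q, fun i j hij => ?_⟩, ?_⟩
  · have := g.monotone (a := ⟨i, by omega⟩) (b := ⟨j, by omega⟩) hij
    rwa [hp, hp, Sum.Lex.inl_le_inl_iff] at this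
  · have := g.monotone (a := ⟨a + i, by omega⟩) (b := ⟨a + j, by omega⟩)
      (Nat.add_le_add_left (show (i : ℕ) ≤ j from hij) a)
    rwa [hq, hq, Sum.Lex.inr_le_inr_iff] at this
  · ext i : 2
    by_cases hi : (i : ℕ) < a
    · rw [joinMap_of_lt _ _ _ _ hi]
      exact hp ⟨i, hi⟩
    · rw [joinMap_of_not_lt _ _ _ _ hi]
      have h := hq ⟨i - a, by omega⟩
      have h' : (⟨a + (i - a), by omega⟩ : Fin n) = i := Fin.ext (by simp only; omega)
      exact (congrArg g h').symm.trans h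

/-- Otherwise the index `a'` would land in the left summand on one side and in the right summand on
the other. By symmetry the position of the split is determined by the map. -/
theorem le_of_joinMap_eq {a b a' b' n : ℕ} {h : a + b = n} {h' : a' + b' = n} {f : Fin a →o P}
    {g : Fin b →o Q} {f' : Fin a' →o P} {g' : Fin b' →o Q}
    (e : joinMap h f g = joinMap h' f' g') : a ≤ a' := by
  by_contra hlt
  have := DFunLike.congr_fun e ⟨a', by omega⟩
  rw [joinMap_of_lt _ _ _ _ (by simp only; omega), joinMap_of_not_lt _ _ _ _ (by simp)] at this
  exact Sum.inl_ne_inr this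

theorem joinMap_injective {a b n : ℕ} {h : a + b = n} {f f' : Fin a →o P} {g g' : Fin b →o Q}
    (e : joinMap h f g = joinMap h f' g') : f = f' ∧ g = g' := by
  constructor
  · ext i : 2
    have := DFunLike.congr_fun e ⟨i, by omega⟩
    rw [joinMap_of_lt h f g ⟨i, by omega⟩ i.isLt, joinMap_of_lt h f' g' ⟨i, by omega⟩ i.isLt]
      at this
    exact Sum.inl_injective this
  · ext j : 2
    have := DFunLike.congr_fun e ⟨a + j, by omega⟩
    rw [joinMap_of_not_lt _ _ _ _ (by simp), joinMap_of_not_lt _ _ _ _ (by simp)] at this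
    have h' : (⟨a + j - a, by omega⟩ : Fin b) = j := Fin.ext (by simp)
    have h'' := Sum.inr_injective this
    simpa only [h'] using h''

/-- By `lt_cut_iff`, precomposing with `f` moves the split from `a` to `cut f a`. This is what makes
the operators of the join correspond to precomposition. -/
theorem joinMap_comp {m n a b : ℕ} (h : a + b = n) (f₀ : Fin a →o P) (f₁ : Fin b →o Q)
    (f : Fin m →o Fin n) :
    joinMap (Nat.add_sub_of_le (cut_le f a)) (f₀.comp (fstPart f h)) (f₁.comp (sndPart f h)) =
      (joinMap h f₀ f₁).comp f := by
  ext i : 2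
  have hi := lt_cut_iff f a i
  rw [OrderHom.comp_coe, Function.comp_apply]
  by_cases hlt : (i : ℕ) < cut f a
  · rw [joinMap_of_lt _ _ _ _ hlt, joinMap_of_lt _ _ _ _ (hi.1 hlt)]
    rfl
  · rw [joinMap_of_not_lt _ _ _ _ hlt, joinMap_of_not_lt _ _ _ _ (hi.not.1 hlt)]
    have h' : (⟨cut f a + (i - cut f a), by omega⟩ : Fin m) = i := Fin.ext (by simp only; omega)
    have h'' : sndPart f h ⟨i - cut f a, by omega⟩ = ⟨f i - a, by omega⟩ :=
      Fin.ext (congrArg (fun k => (f k : ℕ) - a) h')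
    rw [OrderHom.comp_coe, Function.comp_apply, h'']

end

/-! ### The nerve structure on a join. -/

/-- The simplices of a join with `n` vertices. -/
def simplicesJoinEquiv (X Y : ASS.{u}) : ∀ n, simplices (join X Y) n ≃ JoinSimplex X Y n
  | 0 => Equiv.refl _
  | _ + 1 => Equiv.refl _

/-- The cases follow those of `pull`; beyond the uniqueness of maps out of the empty ordinal
everything is definitional. -/
theorem simplicesJoinEquiv_pull (X Y : ASS.{u}) : ∀ {m n : ℕ} (f : Fin m →o Fin n)
    (x : simplices (join X Y) n),
    simplicesJoinEquiv X Y m (pull (join X Y) f x) = joinPull X Y f (simplicesJoinEquiv X Y n x)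
  | 0, 0, f, x => by
    rw [show f = OrderHom.id from OrderHom.ext _ _ (funext fun i => i.elim0), joinPull_id]
    rfl
  | 0, n + 1, f, x => by
    rw [show f = ⟨Fin.elim0, fun i => i.elim0⟩ from OrderHom.ext _ _ (funext fun i => i.elim0)]
    rfl
  | _ + 1, 0, f, _ => (f 0).elim0
  | _ + 1, _ + 1, _, _ => rfl

namespace NerveModel

variable {X Y : ASS.{u}} {P Q : Type*} [PartialOrder P] [PartialOrder Q]

/-- The monotone map corresponding to a simplex of the join of two nerves. -/
def joinFun (M : NerveModel X P) (N : NerveModel Y Q) {n : ℕ} (z : JoinSimplex X Y n) :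
    Fin n →o P ⊕ₗ Q :=
  joinMap z.add_eq (M.equiv _ z.x) (N.equiv _ z.y)

theorem joinFun_bijective (M : NerveModel X P) (N : NerveModel Y Q) (n : ℕ) :
    Function.Bijective (M.joinFun N : JoinSimplex X Y n → _) := by
  constructor
  · rintro ⟨a, b, h, x, y⟩ ⟨a', b', h', x', y'⟩ e
    obtain rfl : a = a' := le_antisymm (le_of_joinMap_eq e) (le_of_joinMap_eq e.symm)
    obtain rfl : b = b' := by omega
    obtain ⟨e₀, e₁⟩ := joinMap_injective e
    obtain rfl : x = x' := (M.equiv a).injective e₀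
    obtain rfl : y = y' := (N.equiv b).injective e₁
    rfl
  · intro g
    obtain ⟨a, b, h, f₀, f₁, rfl⟩ := exists_eq_joinMap g
    exact ⟨⟨a, b, h, (M.equiv a).symm f₀, (N.equiv b).symm f₁⟩, by simp [joinFun]⟩

theorem joinFun_joinPull (M : NerveModel X P) (N : NerveModel Y Q) {m n : ℕ} (f : Fin m →o Fin n)
    (z : JoinSimplex X Y n) : M.joinFun N (joinPull X Y f z) = (M.joinFun N z).comp f := by
  change joinMap _ (M.equiv (cut f z.a) (pull X (fstPart f z.add_eq) z.x))
    (N.equiv (m - cut f z.a) (pull Y (sndPart f z.add_eq) z.y)) = _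
  rw [M.equiv_pull, N.equiv_pull, joinMap_comp]
  rfl

/-- The join of two nerves is the nerve of the lexicographic sum. -/
noncomputable def join (M : NerveModel X P) (N : NerveModel Y Q) :
    NerveModel (AugJoin.join X Y) (P ⊕ₗ Q) where
  equiv n := (simplicesJoinEquiv X Y n).trans (Equiv.ofBijective _ (M.joinFun_bijective N n))
  equiv_pull f x := by
    simp only [Equiv.trans_apply, simplicesJoinEquiv_pull, Equiv.ofBijective_apply,
      joinFun_joinPull]

end NerveModel

/-! ### The poset of vertices of a simplicial sphere -/

/-- The vertices `± eᵢ` of the cross-polytope of dimension `n`. -/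
@[ext]
structure SignedIndex (n : ℕ) where
  idx : Fin n
  sign : Bool

namespace SignedIndex

/-- Distinct vertices are comparable exactly when their indices differ, so a chain never contains
both eᵢ and -eᵢ. -/
instance (n : ℕ) : PartialOrder (SignedIndex n) where
  le x y := x.idx < y.idx ∨ x = y
  le_refl _ := Or.inr rfl
  le_trans x y z := by
    rintro (h | rfl) (h' | rfl)
    exacts [Or.inl (h.trans h'), Or.inl h, Or.inl h', Or.inr rfl]
  le_antisymm x y := by
    rintro (h | h) (h' | h')
    exacts [(lt_asymm h h').elim, h'.symm, h, h]

theorem le_iff {n : ℕ} {x y : SignedIndex n} : x ≤ y ↔ x.idx < y.idx ∨ x = y := Iff.rfl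

theorem idx_monotone (n : ℕ) : Monotone (idx : SignedIndex n → Fin n) := by
  rintro x y (h | rfl)
  exacts [h.le, le_rfl]

theorem eq_of_le_of_idx_eq {n : ℕ} {x y : SignedIndex n} (h : x ≤ y) (e : x.idx = y.idx) :
    x = y :=
  h.resolve_left (e ▸ lt_irrefl _)

/-- The lexicographic sum of the vertex posets of two cross-polytopes. -/
noncomputable def sumEquiv {p q r : ℕ} (h : p + q = r) :
    SignedIndex p ⊕ₗ SignedIndex q ≃o SignedIndex r :=
  RelIso.ofSurjective
    (OrderEmbedding.ofMapLEIff
      (fun z => Sum.elim (fun x : SignedIndex p => (⟨⟨x.idx, by omega⟩, x.sign⟩ : SignedIndex r))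
        (fun y : SignedIndex q => ⟨⟨p + y.idx, by omega⟩, y.sign⟩) (ofLex z))
      (by
        intro x y
        induction x using Lex.rec with | _ x
        induction y using Lex.rec with | _ y
        rcases x with x | x <;> rcases y with y | y <;> have hx := x.idx.isLt <;>
          have hy := y.idx.isLt <;>
          simp only [Sum.Lex.toLex_le_toLex, Sum.lex_inl_inl, Sum.lex_inr_inr, Sum.Lex.sep,
            Sum.lex_inr_inl, ofLex_toLex, Sum.elim_inl, Sum.elim_inr, le_iff,
            SignedIndex.ext_iff, Fin.ext_iff, Fin.lt_def] <;> grind))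
    (by
      rintro ⟨i, s⟩
      by_cases hi : (i : ℕ) < p
      · exact ⟨toLex (Sum.inl ⟨⟨i, hi⟩, s⟩), rfl⟩
      · refine ⟨toLex (Sum.inr ⟨⟨i - p, by omega⟩, s⟩), ?_⟩
        ext
        · simp only [OrderEmbedding.coe_ofMapLEIff, ofLex_toLex, Sum.elim_inr]
          omega
        · rfl)

end SignedIndex

/-! ### The simplicial spheres as nerves. -/

/-- The sign of a simplex of the simplicial `0`-sphere. -/
def sphereZeroVertex {k : ℕ} : simplices sphereZero.{u} (k + 1) → SignedIndex 1
  | Sum.inl _ => ⟨0, false⟩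
  | Sum.inr _ => ⟨0, true⟩

/-- The monotone map corresponding to a simplex of the simplicial `0`-sphere. -/
def sphereZeroFun : ∀ n, simplices sphereZero.{u} n → (Fin n →o SignedIndex 1)
  | 0, _ => ⟨Fin.elim0, fun i => i.elim0⟩
  | _ + 1, x => OrderHom.const _ (sphereZeroVertex x)

theorem sphereZeroFun_bijective : ∀ n, Function.Bijective (sphereZeroFun.{u} n)
  | 0 => ⟨fun _ _ _ => rfl, fun _ => ⟨PUnit.unit, OrderHom.ext _ _ (funext fun i => i.elim0)⟩⟩
  | k + 1 => by
    have hs (a b : (SSet.stdSimplex.{u}.obj (.mk 0)).obj (op (.mk k))) : a = b :=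
      SSet.stdSimplex.objEquiv.injective (Subsingleton.elim _ _)
    constructor
    · intro x y e
      have e' : sphereZeroVertex x = sphereZeroVertex y := DFunLike.congr_fun e 0
      rcases x with x | x <;> rcases y with y | y
      · exact congrArg Sum.inl (hs x y)
      · exact absurd (congrArg SignedIndex.sign e') Bool.false_ne_true
      · exact absurd (congrArg SignedIndex.sign e').symm Bool.false_ne_true
      · exact congrArg Sum.inr (hs x y)
    · intro g
      -- There is only one index, so comparable elements are equal and `g` is constant.
      have hg (i : Fin (k + 1)) : g 0 = g i :=
        SignedIndex.eq_of_le_of_idx_eq (g.monotone (Fin.zero_le i)) (Subsingleton.elim _ _)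
      let v : (SSet.stdSimplex.{u}.obj (.mk 0)).obj (op (.mk k)) :=
        SSet.stdSimplex.objEquiv.symm (SimplexCategory.const _ _ 0)
      have key : ∃ x : simplices sphereZero.{u} (k + 1), sphereZeroVertex x = g 0 := by
        cases hsg : (g 0).sign
        · exact ⟨Sum.inl v, SignedIndex.ext (Subsingleton.elim _ _) hsg.symm⟩
        · exact ⟨Sum.inr v, SignedIndex.ext (Subsingleton.elim _ _) hsg.symm⟩
      obtain ⟨x, hx⟩ := key
      exact ⟨x, OrderHom.ext _ _ (funext fun i => hx.trans (hg i))⟩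

theorem sphereZeroFun_pull : ∀ {m n : ℕ} (f : Fin m →o Fin n) (x : simplices sphereZero.{u} n),
    sphereZeroFun m (pull sphereZero f x) = (sphereZeroFun n x).comp f
  | 0, _, _, _ => OrderHom.ext _ _ (funext fun i => i.elim0)
  | _ + 1, 0, f, _ => (f 0).elim0
  | _ + 1, _ + 1, _, Sum.inl _ => rfl
  | _ + 1, _ + 1, _, Sum.inr _ => rfl

/-- The simplicial `0`-sphere is the nerve of the two-point antichain. -/
noncomputable def sphereZeroModel : NerveModel sphereZero.{u} (SignedIndex 1) where
  equiv n := Equiv.ofBijective _ (sphereZeroFun_bijective n)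
  equiv_pull f x := sphereZeroFun_pull f x

/-- The simplicial `n`-sphere is the nerve of the poset of vertices of the cross-polytope. -/
noncomputable def simplicialSphereModel :
    ∀ n, NerveModel (simplicialSphere.{u} n) (SignedIndex (n + 1))
  | 0 => sphereZeroModel
  | n + 1 => ((simplicialSphereModel n).join sphereZeroModel).congr (SignedIndex.sumEquiv rfl)

/-- The join of two simplicial spheres is a simplicial sphere. -/
noncomputable def joinSphereIso (p q : ℕ) :
    join (simplicialSphere.{u} p) (simplicialSphere.{u} q) ≅ simplicialSphere.{u} (p + q + 1) :=
  (((simplicialSphereModel p).join (simplicialSphereModel q)).congr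
    (SignedIndex.sumEquiv (by omega))).iso (simplicialSphereModel (p + q + 1))

/-! ### Characteristic maps of a geometric realisation -/

/-- The characteristic map of a simplex of a simplicial set. -/
noncomputable def charMap (X : SSet.{u}) {n : ℕ} (x : X.obj (op (.mk n))) :
    C(stdSimplex ℝ (Fin (n + 1)), SSet.toTop.obj X) :=
  (TopCat.Hom.hom (SSet.toTopSimplex.{u}.inv.app (.mk n) ≫
    SSet.toTop.map (SSet.yonedaEquiv.symm x))).comp ⟨ULift.up, continuous_uliftUp⟩

/-- The adjoint transpose of `g` is the unit followed by `g`, and the unit at `x` is the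
characteristic map of `x`. This turns the adjunction into statements about restrictions to
simplices. -/
theorem toSSetObjEquiv_homEquiv {X : SSet.{u}} {T : TopCat.{u}} (g : SSet.toTop.obj X ⟶ T)
    {n : ℕ} (x : X.obj (op (.mk n))) :
    TopCat.toSSetObjEquiv T (op (.mk n)) ((sSetTopAdj.homEquiv X T g).app (op (.mk n)) x) =
      (TopCat.Hom.hom g).comp (charMap X x) := by
  have h := sSetTopAdj_unit_app_app_down X (op (.mk n)) x
  have h' : ((sSetTopAdj.homEquiv X T g).app (op (.mk n)) x).down =
      (SSet.toTopSimplex.inv.app _ ≫ SSet.toTop.map (SSet.yonedaEquiv.symm x)) ≫ g := by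
    rw [← h, Adjunction.homEquiv_unit]
    rfl
  ext t
  exact congrArg (fun k => TopCat.Hom.hom k (ULift.up t)) h'

theorem toSSetObjEquiv_map {T : TopCat.{u}} {m n : ℕ}
    (f : SimplexCategory.mk m ⟶ SimplexCategory.mk n)
    (y : (TopCat.toSSet.obj T).obj (op (.mk n))) (t : stdSimplex ℝ (Fin (m + 1))) :
    TopCat.toSSetObjEquiv T (op (.mk m)) ((TopCat.toSSet.obj T).map f.op y) t =
      TopCat.toSSetObjEquiv T (op (.mk n)) y (stdSimplex.map f t) :=
  rfl

/-- This is the naturality of the adjunction unit, obtained as the transpose of the identity. -/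
theorem charMap_map (X : SSet.{u}) {m n : ℕ} (f : SimplexCategory.mk m ⟶ SimplexCategory.mk n)
    (x : X.obj (op (.mk n))) (t : stdSimplex ℝ (Fin (m + 1))) :
    charMap X (X.map f.op x) t = charMap X x (stdSimplex.map f t) := by
  have h₁ := toSSetObjEquiv_homEquiv (𝟙 (SSet.toTop.obj X)) (X.map f.op x)
  have h₂ := toSSetObjEquiv_homEquiv (𝟙 (SSet.toTop.obj X)) x
  have h₃ := (sSetTopAdj.homEquiv X _ (𝟙 (SSet.toTop.obj X))).naturality_apply f.op x
  rw [h₃] at h₁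
  rw [TopCat.hom_id, ContinuousMap.id_comp] at h₁ h₂
  rw [← h₁, ← h₂]
  exact toSSetObjEquiv_map f _ t

/-- A compatible family of maps from the topological simplices glues. -/
theorem exists_glue (X : SSet.{u}) (T : TopCat.{u})
    (φ : ∀ n, X.obj (op (.mk n)) → C(stdSimplex ℝ (Fin (n + 1)), T))
    (hφ : ∀ {m n : ℕ} (f : SimplexCategory.mk m ⟶ SimplexCategory.mk n) (x : X.obj (op (.mk n)))
      (t : stdSimplex ℝ (Fin (m + 1))), φ m (X.map f.op x) t = φ n x (stdSimplex.map f t)) :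
    ∃ F : C(SSet.toTop.obj X, T),
      ∀ (n : ℕ) (x : X.obj (op (.mk n))) (t), F (charMap X x t) = φ n x t := by
  let ψ : X ⟶ TopCat.toSSet.obj T :=
    { app := fun Δ => TypeCat.ofHom fun x => (TopCat.toSSetObjEquiv T Δ).symm (φ Δ.unop.len x)
      naturality := by
        intro Δ Δ' f
        ext x
        apply (TopCat.toSSetObjEquiv T Δ').injective
        ext t
        have := hφ (m := Δ'.unop.len) (n := Δ.unop.len) f.unop x t
        exact (DFunLike.congr_fun (Equiv.apply_symm_apply _ _) t).trans this }
  refine ⟨TopCat.Hom.hom ((sSetTopAdj.homEquiv X T).symm ψ), fun n x t => ?_⟩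
  have h := toSSetObjEquiv_homEquiv ((sSetTopAdj.homEquiv X T).symm ψ) x
  rw [Equiv.apply_symm_apply] at h
  refine (DFunLike.congr_fun h t).symm.trans ?_
  exact DFunLike.congr_fun (Equiv.apply_symm_apply _ _) t

theorem hom_ext_charMap (X : SSet.{u}) {T : TopCat.{u}} (F G : C(SSet.toTop.obj X, T))
    (h : ∀ (n : ℕ) (x : X.obj (op (.mk n))) (t), F (charMap X x t) = G (charMap X x t)) :
    F = G := by
  have : (sSetTopAdj.homEquiv X T) (TopCat.ofHom F) =
      (sSetTopAdj.homEquiv X T) (TopCat.ofHom G) := by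
    ext Δ x
    apply (TopCat.toSSetObjEquiv T Δ).injective
    refine (toSSetObjEquiv_homEquiv (n := Δ.unop.len) _ x).trans
      (Eq.trans ?_ (toSSetObjEquiv_homEquiv (n := Δ.unop.len) _ x).symm)
    ext t
    exact h _ x t
  exact congrArg TopCat.Hom.hom ((sSetTopAdj.homEquiv X T).injective this)

/-- The characteristic maps jointly cover the realisation. -/
theorem exists_charMap_eq (X : SSet.{u}) (z : SSet.toTop.obj X) :
    ∃ (n : ℕ) (x : X.obj (op (.mk n))) (t : stdSimplex ℝ (Fin (n + 1))), charMap X x t = z := by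
  -- Every map to an indiscrete space is continuous, so "being in the image of a characteristic map"
  -- and "true" are continuous maps that agree on all characteristic maps, hence everywhere.
  let F : C(SSet.toTop.obj X, TopCat.trivial.obj (ULift.{u} Prop)) :=
    @ContinuousMap.mk _ _ _ ⊤ (fun z => ULift.up (∃ (n : ℕ) (x : X.obj (op (.mk n)))
      (t : stdSimplex ℝ (Fin (n + 1))), charMap X x t = z)) continuous_top
  let G : C(SSet.toTop.obj X, TopCat.trivial.obj (ULift.{u} Prop)) :=
    @ContinuousMap.mk _ _ _ ⊤ (fun _ => ULift.up True) continuous_top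
  have h : F = G := hom_ext_charMap X F G fun n x t =>
    congrArg ULift.up (eq_true ⟨n, x, t, rfl⟩)
  exact of_eq_true (congrArg ULift.down (DFunLike.congr_fun h z))

/-! ### The cross-polytope -/

namespace SignedIndex

/-- The sign `± 1` of a boolean. -/
def sgn (b : Bool) : ℝ := if b then 1 else -1

@[simp]
theorem abs_sgn (b : Bool) : |sgn b| = 1 := by
  cases b <;> simp [sgn]

theorem sgn_injective : Function.Injective sgn := by
  intro a b h
  cases a <;> cases b <;> simp [sgn] at h ⊢ <;> norm_num at h

variable {N k : ℕ}

/-- The coordinates of the vertex `± eᵢ` of the cross-polytope. -/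
def coord (v : SignedIndex N) (i : Fin N) : ℝ := if v.idx = i then sgn v.sign else 0

/-- The point with barycentric coordinates `t` in the simplex with vertices `g`. -/
noncomputable def combo (g : Fin k → SignedIndex N) (t : stdSimplex ℝ (Fin k)) :
    EuclideanSpace ℝ (Fin N) :=
  WithLp.toLp 2 fun i => ∑ j, t j * (g j).coord i

theorem continuous_combo (g : Fin k → SignedIndex N) : Continuous (combo g) := by
  unfold combo
  refine (PiLp.continuous_toLp 2 _).comp (continuous_pi fun i => continuous_finsetSum _ fun j _ => ?_)
  exact ((continuous_apply j).comp continuous_subtype_val).mul continuous_const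

theorem combo_map {l : ℕ} (g : Fin k → SignedIndex N) (f : Fin l → Fin k)
    (t : stdSimplex ℝ (Fin l)) : combo g (stdSimplex.map f t) = combo (g ∘ f) t := by
  ext i
  simp only [combo, stdSimplex.map_coe, FunOnFinite.linearMap_apply_apply, Finset.sum_mul,
    Function.comp_apply]
  rw [← Finset.sum_fiberwise (g := f)]
  refine Finset.sum_congr rfl fun j _ => Finset.sum_congr rfl fun a ha => ?_
  rw [(Finset.mem_filter.1 ha).2]

/-- The vertices of the facet of the cross-polytope in the orthant with signs `ε`. -/
def facet (ε : Fin N → Bool) : Fin N →o SignedIndex N where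
  toFun i := ⟨i, ε i⟩
  monotone' i j h := by
    rcases h.lt_or_eq with h | rfl
    exacts [Or.inl h, le_rfl]

theorem combo_facet (ε : Fin N → Bool) (t : stdSimplex ℝ (Fin N)) (i : Fin N) :
    combo (facet ε) t i = t i * sgn (ε i) := by
  change ∑ j, t j * (if j = i then sgn (ε j) else 0) = _
  simp

theorem abs_combo_facet (ε : Fin N → Bool) (t : stdSimplex ℝ (Fin N)) (i : Fin N) :
    |combo (facet ε) t i| = t i := by
  rw [combo_facet, abs_mul, abs_sgn, mul_one, abs_of_nonneg (stdSimplex.zero_le t i)]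

/-- Every simplex of the boundary of the cross-polytope lies in a facet. -/
theorem exists_eq_facet_comp (g : Fin k →o SignedIndex N) :
    ∃ (ε : Fin N → Bool) (f : Fin k →o Fin N), g = (facet ε).comp f := by
  classical
  -- The sign at `i` is read off from the vertices of `g` with index `i`; indices that do not occur
  -- get the default `false`.
  refine ⟨fun i => decide (∃ j, (g j).idx = i ∧ (g j).sign = true),
    ⟨fun j => (g j).idx, (idx_monotone N).comp g.monotone⟩, ?_⟩
  ext j : 2
  refine SignedIndex.ext rfl ?_
  change _ = decide (∃ j', (g j').idx = (g j).idx ∧ (g j').sign = true)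
  rw [Bool.eq_iff_iff, decide_eq_true_iff]
  refine ⟨fun h => ⟨j, rfl, h⟩, ?_⟩
  rintro ⟨j', e, h⟩
  -- Vertices of a chain with the same index coincide, so the sign does not depend on the vertex
  -- chosen.
  rcases le_total j j' with hj | hj
  · rwa [eq_of_le_of_idx_eq (g.monotone hj) e.symm]
  · rwa [← eq_of_le_of_idx_eq (g.monotone hj) e]

theorem combo_ne_zero (g : Fin k →o SignedIndex N) (t : stdSimplex ℝ (Fin k)) :
    combo g t ≠ 0 := by
  obtain ⟨ε, f, rfl⟩ := exists_eq_facet_comp g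
  intro h
  -- In a facet the barycentric coordinates are the absolute values of the coordinates, so they
  -- would all vanish although they sum to 1.
  have h0 : ∀ i, stdSimplex.map f t i = 0 := fun i => by
    rw [← abs_combo_facet ε, combo_map]
    change |combo ((facet ε).comp f) t i| = 0
    rw [h]
    simp
  simpa [h0] using stdSimplex.sum_eq_one (stdSimplex.map f t)

/-- The radial projection of a point of a simplex of the cross-polytope to the unit sphere. -/
noncomputable def radial (g : Fin k →o SignedIndex N) :
    C(stdSimplex ℝ (Fin k), Metric.sphere (0 : EuclideanSpace ℝ (Fin N)) 1) where
  toFun t := ⟨‖combo g t‖⁻¹ • combo g t, by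
    rw [mem_sphere_zero_iff_norm, norm_smul, norm_inv, norm_norm,
      inv_mul_cancel₀ (norm_ne_zero_iff.2 (combo_ne_zero g t))]⟩
  continuous_toFun := by
    have h : Continuous fun t => ‖combo g t‖⁻¹ :=
      (continuous_combo g).norm.inv₀ fun t => norm_ne_zero_iff.2 (combo_ne_zero g t)
    exact (h.smul (continuous_combo g)).subtype_mk _

theorem radial_map {l : ℕ} (g : Fin k →o SignedIndex N) (f : Fin l →o Fin k)
    (t : stdSimplex ℝ (Fin l)) : radial g (stdSimplex.map f t) = radial (g.comp f) t := by
  refine Subtype.ext ?_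
  change ‖combo g (stdSimplex.map f t)‖⁻¹ • combo g (stdSimplex.map f t) = _
  rw [combo_map]
  rfl

/-- A point of a facet is determined by its radial projection. -/
theorem eq_of_radial_facet_eq {ε ε' : Fin N → Bool} {t t' : stdSimplex ℝ (Fin N)}
    (h : radial (facet ε) t = radial (facet ε') t') :
    t = t' ∧ ∀ i, t i ≠ 0 → ε i = ε' i := by
  have hc : ‖combo (facet ε) t‖⁻¹ • combo (facet ε) t =
      ‖combo (facet ε') t'‖⁻¹ • combo (facet ε') t' := congrArg Subtype.val h
  have hi (i : Fin N) : ‖combo (facet ε) t‖⁻¹ * combo (facet ε) t i =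
      ‖combo (facet ε') t'‖⁻¹ * combo (facet ε') t' i := congrArg (fun v => v i) hc
  have ha (i : Fin N) : ‖combo (facet ε) t‖⁻¹ * t i = ‖combo (facet ε') t'‖⁻¹ * t' i := by
    have := congrArg abs (hi i)
    simpa only [abs_mul, abs_combo_facet, abs_inv, abs_norm] using this
  -- Summing over `i` removes the barycentric coordinates, which sum to 1 on both sides, and leaves
  -- the scaling factors.
  have hn : ‖combo (facet ε) t‖⁻¹ = ‖combo (facet ε') t'‖⁻¹ := by
    have := Finset.sum_congr (rfl : (Finset.univ : Finset (Fin N)) = _) fun i _ => ha i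
    simpa only [← Finset.mul_sum, stdSimplex.sum_eq_one, mul_one] using this
  have h0 : ‖combo (facet ε) t‖⁻¹ ≠ 0 := inv_ne_zero (norm_ne_zero_iff.2 (combo_ne_zero _ t))
  rw [← hn] at ha hi
  have ht : t = t' := stdSimplex.ext (funext fun i => mul_left_cancel₀ h0 (ha i))
  refine ⟨ht, fun i hti => sgn_injective ?_⟩
  have := mul_left_cancel₀ h0 (hi i)
  rw [combo_facet, combo_facet, ← ht] at this
  exact mul_left_cancel₀ hti this

/-- The facets of the cross-polytope cover the sphere. -/
theorem exists_radial_facet_eq (v : Metric.sphere (0 : EuclideanSpace ℝ (Fin N)) 1) :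
    ∃ (ε : Fin N → Bool) (t : stdSimplex ℝ (Fin N)), radial (facet ε) t = v := by
  obtain ⟨v, hv⟩ := v
  rw [mem_sphere_zero_iff_norm] at hv
  have hS : 0 < ∑ i, |v i| := by
    refine (Finset.sum_nonneg fun i _ => abs_nonneg (v i)).lt_of_ne fun h => ?_
    have h0 := (Finset.sum_eq_zero_iff_of_nonneg fun i _ => abs_nonneg (v i)).1 h.symm
    have : v = 0 := by
      ext i
      exact abs_eq_zero.1 (h0 i (Finset.mem_univ i))
    rw [this, norm_zero] at hv
    exact zero_ne_one hv
  -- Dividing by the ℓ¹ norm moves `v` to the boundary of the cross-polytope.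
  set S := ∑ i, |v i| with hSdef
  let t : stdSimplex ℝ (Fin N) := ⟨fun i => S⁻¹ * |v i|,
    fun i => mul_nonneg (inv_nonneg.2 hS.le) (abs_nonneg _), by
      rw [← Finset.mul_sum, ← hSdef, inv_mul_cancel₀ hS.ne']⟩
  refine ⟨fun i => decide (0 ≤ v i), t, Subtype.ext ?_⟩
  have hc : combo (facet fun i => decide (0 ≤ v i)) t = S⁻¹ • v := by
    ext i
    rw [combo_facet]
    change S⁻¹ * |v i| * _ = S⁻¹ * v i
    by_cases h : 0 ≤ v i
    · simp [sgn, h, abs_of_nonneg h]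
    · simp [sgn, h, abs_of_neg (not_le.1 h)]
  change ‖combo (facet fun i => decide (0 ≤ v i)) t‖⁻¹ • combo (facet fun i => decide (0 ≤ v i)) t
    = v
  rw [hc, norm_smul, hv, mul_one, norm_inv, inv_inv, Real.norm_of_nonneg hS.le, smul_smul,
    mul_inv_cancel₀ hS.ne', one_smul]

end SignedIndex

/-- A point of a simplex is the image of a point of the face spanned by its support. -/
theorem exists_map_support {k : ℕ} (t : stdSimplex ℝ (Fin k)) :
    ∃ (m : ℕ) (f : Fin (m + 1) →o Fin k) (s : stdSimplex ℝ (Fin (m + 1))),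
      stdSimplex.map f s = t ∧ ∀ j, t (f j) ≠ 0 := by
  classical
  set I : Finset (Fin k) := Finset.univ.filter fun i => t i ≠ 0 with hI
  have hsum : ∑ i ∈ I, t i = 1 := by
    rw [hI, Finset.sum_filter_ne_zero, stdSimplex.sum_eq_one]
  obtain ⟨m, hm⟩ : ∃ m, I.card = m + 1 := by
    refine Nat.exists_eq_succ_of_ne_zero fun h => ?_
    rw [Finset.card_eq_zero.1 h, Finset.sum_empty] at hsum
    exact zero_ne_one hsum
  let f := I.orderEmbOfFin hm
  have hf (j) : t (f j) ≠ 0 := (Finset.mem_filter.1 (I.orderEmbOfFin_mem hm j)).2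
  have himg : Finset.univ.image f = I := by
    rw [← Finset.coe_inj, Finset.coe_image, Finset.coe_univ, Set.image_univ,
      Finset.range_orderEmbOfFin]
  have hs : ∑ j, t (f j) = 1 := by
    rw [← hsum, ← himg, Finset.sum_image fun _ _ _ _ h => f.injective h]
  refine ⟨m, (f : Fin (m + 1) →o Fin k),
    ⟨fun j => t (f j), fun j => stdSimplex.zero_le t _, hs⟩, ?_, hf⟩
  ext i
  change FunOnFinite.linearMap ℝ ℝ f (fun j => t (f j)) i = t i
  rw [FunOnFinite.linearMap_apply_apply]
  by_cases hi : t i = 0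
  · rw [hi]
    refine Finset.sum_eq_zero fun j hj => ?_
    rw [(Finset.mem_filter.1 hj).2, hi]
  · have : i ∈ Finset.univ.image f := himg ▸ Finset.mem_filter.2 ⟨Finset.mem_univ i, hi⟩
    obtain ⟨j, -, rfl⟩ := Finset.mem_image.1 this
    rw [Finset.sum_eq_single (f := fun j => t (f j)) j]
    · exact fun j' hj' hne => absurd (f.injective (Finset.mem_filter.1 hj').2) hne
    · exact fun h => (h (by simp)).elim

/-! ### The realisation of the nerve of the poset of vertices -/

namespace NerveModel

variable {X : ASS.{0}} {n : ℕ} (M : NerveModel X (SignedIndex (n + 1)))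

/-- The characteristic map of the simplex corresponding to a monotone map. -/
noncomputable def cell {k : ℕ} (g : Fin (k + 1) →o SignedIndex (n + 1)) :
    C(stdSimplex ℝ (Fin (k + 1)), realisation X) :=
  charMap X.left ((M.equiv (k + 1)).symm g)

theorem cell_comp {k l : ℕ} (g : Fin (k + 1) →o SignedIndex (n + 1))
    (f : Fin (l + 1) →o Fin (k + 1)) (t : stdSimplex ℝ (Fin (l + 1))) :
    M.cell (g.comp f) t = M.cell g (stdSimplex.map f t) := by
  unfold cell
  rw [M.equiv_symm_comp]
  exact charMap_map X.left (SimplexCategory.mkHom f) _ t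

theorem exists_cell_facet_eq (z : realisation X) :
    ∃ (ε : Fin (n + 1) → Bool) (t : stdSimplex ℝ (Fin (n + 1))),
      M.cell (SignedIndex.facet ε) t = z := by
  obtain ⟨k, x, t, rfl⟩ := exists_charMap_eq X.left z
  obtain ⟨ε, f, hf⟩ := SignedIndex.exists_eq_facet_comp (M.equiv (k + 1) x)
  refine ⟨ε, stdSimplex.map f t, ?_⟩
  rw [← cell_comp, ← hf]
  exact congrArg (fun y : X.left.obj (op (.mk k)) => charMap X.left y t)
    (Equiv.symm_apply_apply (M.equiv (k + 1)) x)

/-- The point lies in the face spanned by the support of `t`, and on that face both facets restrict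
to the same chain. -/
theorem cell_facet_congr {ε ε' : Fin (n + 1) → Bool} {t : stdSimplex ℝ (Fin (n + 1))}
    (h : ∀ i, t i ≠ 0 → ε i = ε' i) :
    M.cell (SignedIndex.facet ε) t = M.cell (SignedIndex.facet ε') t := by
  obtain ⟨m, f, s, rfl, hs⟩ := exists_map_support t
  rw [← cell_comp, ← cell_comp]
  congr 2
  ext j : 2
  exact SignedIndex.ext rfl (h _ (hs j))

theorem compactSpace_realisation (M : NerveModel X (SignedIndex (n + 1))) :
    CompactSpace (realisation X) := by
  have h : (Set.univ : Set (realisation X)) =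
      ⋃ ε : Fin (n + 1) → Bool, Set.range (M.cell (SignedIndex.facet ε)) := by
    refine (Set.eq_univ_of_forall fun z => ?_).symm
    obtain ⟨ε, t, h⟩ := M.exists_cell_facet_eq z
    exact Set.mem_iUnion.2 ⟨ε, t, h⟩
  exact ⟨h ▸ isCompact_iUnion fun ε => isCompact_range (M.cell (SignedIndex.facet ε)).continuous⟩

theorem exists_toSphere : ∃ F : C(realisation X,
      Metric.sphere (0 : EuclideanSpace ℝ (Fin (n + 1))) 1),
    ∀ (k : ℕ) (g : Fin (k + 1) →o SignedIndex (n + 1)) (t : stdSimplex ℝ (Fin (k + 1))),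
      F (M.cell g t) = SignedIndex.radial g t := by
  obtain ⟨F, hF⟩ := exists_glue X.left
    (TopCat.of (Metric.sphere (0 : EuclideanSpace ℝ (Fin (n + 1))) 1))
    (fun k x => SignedIndex.radial (M.equiv (k + 1) x)) (by
      intro k l f x t
      refine Eq.trans ?_ (SignedIndex.radial_map _ f.toOrderHom t).symm
      exact congrArg (fun g => SignedIndex.radial g t) (M.equiv_pull f.toOrderHom x))
  refine ⟨F, fun k g t => (hF k _ t).trans ?_⟩
  rw [Equiv.apply_symm_apply]

/-- The realisation of the nerve of the poset of vertices of a cross-polytope is a sphere. -/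
theorem nonempty_homeomorph_sphere (M : NerveModel X (SignedIndex (n + 1))) : Nonempty
    (realisation X ≃ₜ Metric.sphere (0 : EuclideanSpace ℝ (Fin (n + 1))) 1) := by
  obtain ⟨F, hF⟩ := M.exists_toSphere
  have hbij : Function.Bijective F := by
    constructor
    · intro z z' h
      obtain ⟨ε, t, rfl⟩ := M.exists_cell_facet_eq z
      obtain ⟨ε', t', rfl⟩ := M.exists_cell_facet_eq z'
      rw [hF, hF] at h
      obtain ⟨rfl, he⟩ := SignedIndex.eq_of_radial_facet_eq h
      exact M.cell_facet_congr he
    · intro v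
      obtain ⟨ε, t, h⟩ := SignedIndex.exists_radial_facet_eq v
      exact ⟨M.cell (SignedIndex.facet ε) t, (hF _ _ t).trans h⟩
  have := M.compactSpace_realisation
  exact ⟨Continuous.homeoOfEquivCompactToT2 (f := Equiv.ofBijective F hbij) F.continuous⟩

end NerveModel

end AugJoin

theorem mainTheorem4 :
    (∀ p q : ℕ, Nonempty
      (AugJoin.join (AugJoin.simplicialSphere.{0} p) (AugJoin.simplicialSphere.{0} q) ≅
        AugJoin.simplicialSphere.{0} (p + q + 1))) ∧
    (∀ n : ℕ, Nonempty
      (AugJoin.realisation (AugJoin.simplicialSphere.{0} n) ≃ₜ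
        Metric.sphere (0 : EuclideanSpace ℝ (Fin (n + 1))) 1)) :=
  ⟨fun p q => ⟨AugJoin.joinSphereIso p q⟩,
    fun n => (AugJoin.simplicialSphereModel n).nonempty_homeomorph_sphere⟩
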